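/- **Setting.** Let $f:\mathbb{R}^n\to\{1,\dots,K\}$ ($K\ge 1$) be the classifier of a fully connected ReLU network with any number of hidden layers of any widths: $f(x)$ is the label with the highest logit, the first such label in case of a tie. Let $\mathcal S$ be a set of $k$ sensitive coordinates (features), let each $S_i\in\mathcal S$ have a finite domain $domain(S_i)\subset\mathbb{R}$, and let $domain(\mathcal S)=\prod_i domain(S_i)$. For $x\in\mathbb{R}^n$ write $x_{\setminus\mathcal S}$ and $x_{\mathcal S}$ for its non-sensitive and sensitive features, and for $s\in domain(\mathcal S)$ let $f_s(u)$ be the label $f(x)$ of the point $x$ with $x_{\setminus\mathcal S}=u$, $x_{\mathcal S}=s$. *Fairness.* For $\epsilon\ge 0$, $f$ is $\epsilon$-individually fair at $x^*$ if $f(x)=f(x^*)$ for all $x$ with $x_{\mathcal S}\in domain(\mathcal S)$ and $\|x_{\setminus\mathcal S}-x^*_{\setminus\mathcal S}\|_2\le\epsilon$. The local individual fairness parameter is $\epsilon_{IF}=\sup\{\epsilon\ge 0: f \text{ is } \epsilon\text{-individually fair at } x^*\}\in[0,\infty]$. The pointwise robustness of $f_s$ at $u$ is $\rho_s(u)=\sup\{\epsilon\ge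 0:\ \|v-u\|_2\le\epsilon\Rightarrow f_s(v)=f_s(u)\}\in[0,\infty]$. *FairProof (certificate computation).* Let $\mathbb{P}$ be the collection of the full-dimensional polytopes $\{x\mid \mathbf{A}x\le \mathbf{b}\}$ on which the activation code of the hidden neurons is a given one and a given label has the highest logit. For each $s\in domain(\mathcal S)$: 1. substitute $x_{\mathcal S}=s$ in the inequalities of the polytopes of $\mathbb{P}$, and let $\mathbb{P}'_s$ consist of the resulting polytopes that have dimension $n-k$; 2. run GeoCert on $\mathbb{P}'_s$ from $x^*_{\setminus\mathcal S}$ with the distance $d_{proj}(u,F)=|b-a^Tu|/\|a\|_2$ to the hyperplane $a^Ty=b$ that contains the facet $F$. That is: start from a polytope of $\mathbb{P}'_s$ that contains $x^*_{\setminus\mathcal S}$, mark it as seen and push its facets with their distances into a priority queue. Repeatedly pop a facet of least distance (ties broken arbitrarily). If it is contained in the decision boundary of $f_s$ (the union over $c$ of the topological boundaries of the regions $\{f_s=c\}$), return its distance. Otherwise push the facets of every unseen polytope of $\mathbb{P}'_s$ that has this facet, and mark these polytopes as seen. Return $\infty$ if the queue becomes empty. The output $\epsilon$ is the minimum of the values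 $\epsilon_s\in[0,\infty]$ returned for $s\in domain(\mathcal S)$ (and $\infty$ if $domain(\mathcal S)$ is empty). **Theorem (Correctness of FairProof).** Suppose that, for every $s\in domain(\mathcal S)$, every decision region $\{f_s=c\}$ is contained in the closure of its interior (there are no lower-dimensional pieces of decision regions). Let $x^*\in\mathbb{R}^n$ be any data point. Then FairProof can complete a run and produce an output for $x^*$, and every output $\epsilon$ that it can produce satisfies * $\epsilon\le \rho_s(x^*_{\setminus\mathcal S})$ for all $s\in domain(\mathcal S)$, that is, $\epsilon$ is at most the minimum over all sensitive values of the true robustness with the sensitive features fixed; and * $\epsilon\le\epsilon_{IF}$, provided that the condition of individual fairness at $x^*$ holds for at least one $\epsilon\ge 0$ (equivalently, for $\epsilon=0$). -/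

import Mathlib

open scoped ENNReal NNReal Matrix

noncomputable section

/-- The Euclidean norm on `ℝ^ι`. -/
def l2Norm {ι : Type} [Fintype ι] (v : ι → ℝ) : ℝ :=
  ‖(WithLp.toLp 2 v : EuclideanSpace ℝ ι)‖

/-! ### Fully connected networks with ReLU activations -/

/-- Weights of a fully connected ReLU network with `K` outputs (logits); the index is the input
dimension. The number and the widths of the hidden layers are arbitrary. -/
inductive ReLUNet (K : ℕ) : ℕ → Type
  | output {n : ℕ} (W : Matrix (Fin K) (Fin n) ℝ) (b : Fin K → ℝ) : ReLUNet K n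
  | hidden {n m : ℕ} (W : Matrix (Fin m) (Fin n) ℝ) (b : Fin m → ℝ) (rest : ReLUNet K m) :
      ReLUNet K n

namespace ReLUNet

/-- The logits of the network. -/
def logits {K : ℕ} : {n : ℕ} → ReLUNet K n → (Fin n → ℝ) → Fin K → ℝ
  | _, output W b, x => W *ᵥ x + b
  | _, hidden W b rest, x => rest.logits (fun i => max ((W *ᵥ x + b) i) 0)

/-- The labels of highest score at `x`. -/
def topLabels {K n : ℕ} (N : ReLUNet K n) (x : Fin n → ℝ) : Finset (Fin K) :=
  Finset.univ.filter (fun c => ∀ j, N.logits x j ≤ N.logits x c)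

theorem topLabels_nonempty {K n : ℕ} [NeZero K] (N : ReLUNet K n) (x : Fin n → ℝ) :
    (N.topLabels x).Nonempty := by
  obtain ⟨c, -, hc⟩ := Finset.exists_max_image (Finset.univ : Finset (Fin K)) (N.logits x)
    ⟨0, Finset.mem_univ _⟩
  exact ⟨c, by simpa [topLabels] using hc⟩

/-- The classifier: the label with the highest logit (the first one, if there is a tie). -/
def predict {K n : ℕ} [NeZero K] (N : ReLUNet K n) (x : Fin n → ℝ) : Fin K :=
  (N.topLabels x).min' (N.topLabels_nonempty x)

/-- ReLU activation codes: one bit for each hidden neuron (`true` for active). -/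
def Code {K : ℕ} : {n : ℕ} → ReLUNet K n → Type
  | _, output _ _ => Unit
  | _, hidden (m := m) _ _ rest => (Fin m → Bool) × rest.Code

end ReLUNet

/-! ### Polytopes given by linear inequalities -/

/-- The linear inequality `a · x ≤ b`. -/
structure Halfspace (ι : Type) where
  a : ι → ℝ
  b : ℝ

/-- A (possibly unbounded) polytope `{x | A x ≤ b}`, given by the list of the rows of `(A | b)`. -/
abbrev HPolytope (ι : Type) := List (Halfspace ι)

section Polytopes

variable {ι : Type} [Fintype ι]

/-- The set of points of a polytope. -/
def HPolytope.carrier (P : HPolytope ι) : Set (ι → ℝ) :=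
  {x | ∀ h ∈ P, h.a ⬝ᵥ x ≤ h.b}

/-- The polytope is full-dimensional. -/
def HPolytope.FullDim (P : HPolytope ι) : Prop :=
  (interior P.carrier).Nonempty

/-- The face of `P` on which the inequality `h` is an equality. -/
def HPolytope.face (P : HPolytope ι) (h : Halfspace ι) : Set (ι → ℝ) :=
  {x | x ∈ P.carrier ∧ h.a ⬝ᵥ x = h.b}

/-- The set `F` has dimension `|ι| - 1`. -/
def IsCodimOne (F : Set (ι → ℝ)) : Prop :=
  F.Nonempty ∧ Module.finrank ℝ (vectorSpan ℝ F) + 1 = Fintype.card ι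

/-- The facets of a polytope: its faces `{x ∈ P | A_i x = b_i}` of codimension one. -/
def HPolytope.facets (P : HPolytope ι) : Set (Set (ι → ℝ)) :=
  {F | ∃ h ∈ P, F = P.face h ∧ IsCodimOne F}

/-- The projection distance from `x` to the hyperplane `a · y = b` that bounds `h`. -/
def projDist (x : ι → ℝ) (h : Halfspace ι) : ℝ :=
  |(h.b - h.a ⬝ᵥ x) / l2Norm h.a|

/-- The facets of `P`, each one with the projection distance from `x` to its hyperplane. -/
def HPolytope.entries (x : ι → ℝ) (P : HPolytope ι) : Set (ℝ × Set (ι → ℝ)) :=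
  {e | ∃ h ∈ P, IsCodimOne (P.face h) ∧ e = (projDist x h, P.face h)}

/-- The polytopes of the complex `PP` that share the facet `F`. -/
def neighbors (PP : Set (HPolytope ι)) (F : Set (ι → ℝ)) : Set (HPolytope ι) :=
  {P | P ∈ PP ∧ F ∈ P.facets}

/-- The decision boundary of a classifier. -/
def decisionBoundary {Y : Type} (g : (ι → ℝ) → Y) : Set (ι → ℝ) :=
  {u | ∃ c, u ∈ frontier {v | g v = c}}

/-- The facet `F` is a boundary facet of the classifier `g`. -/
def IsBoundary {Y : Type} (g : (ι → ℝ) → Y) (F : Set (ι → ℝ)) : Prop :=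
  F ⊆ decisionBoundary g

/-- The loop of GeoCert with the projection distance, for the point `x`, the complex `PP` and the
classifier `g`. `GeoCertLoop g PP x Q C ε` says that, started with the priority queue `Q` and the
set `C` of seen polytopes, the loop can halt with the value `ε`. A facet of least distance is
popped (any one, if there are several). If it is a boundary facet, its distance is returned;
otherwise the facets of all unseen polytopes that share it are pushed, and these polytopes become
seen. The value is `∞` when the queue runs empty without a boundary facet having been popped. -/
inductive GeoCertLoop {Y : Type} (g : (ι → ℝ) → Y) (PP : Set (HPolytope ι)) (x : ι → ℝ) :
    Set (ℝ × Set (ι → ℝ)) → Set (HPolytope ι) → ℝ≥0∞ → Prop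
  | exhausted (C : Set (HPolytope ι)) : GeoCertLoop g PP x ∅ C ∞
  | found (Q : Set (ℝ × Set (ι → ℝ))) (C : Set (HPolytope ι)) (d : ℝ) (F : Set (ι → ℝ))
      (hmem : (d, F) ∈ Q) (hmin : ∀ e ∈ Q, d ≤ e.1) (hF : IsBoundary g F) :
      GeoCertLoop g PP x Q C (ENNReal.ofReal d)
  | expand (Q : Set (ℝ × Set (ι → ℝ))) (C : Set (HPolytope ι)) (d : ℝ) (F : Set (ι → ℝ))
      (ε : ℝ≥0∞) (hmem : (d, F) ∈ Q) (hmin : ∀ e ∈ Q, d ≤ e.1) (hF : ¬ IsBoundary g F)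
      (hrest : GeoCertLoop g PP x ((Q \ {(d, F)}) ∪ ⋃ P ∈ neighbors PP F \ C, P.entries x)
        (C ∪ neighbors PP F) ε) :
      GeoCertLoop g PP x Q C ε

/-- GeoCert with the projection distance can return `ε`: the loop is started from a polytope of the
complex that contains `x`. -/
def GeoCert {Y : Type} (g : (ι → ℝ) → Y) (PP : Set (HPolytope ι)) (x : ι → ℝ) (ε : ℝ≥0∞) : Prop :=
  ∃ P ∈ PP, x ∈ P.carrier ∧ GeoCertLoop g PP x (P.entries x) {P} ε

/-- The pointwise `ℓ₂` robustness of the classifier `g` at `u`. -/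
def robustnessRadius {Y : Type} (g : (ι → ℝ) → Y) (u : ι → ℝ) : ℝ≥0∞ :=
  ⨆ (ε : ℝ≥0) (_ : ∀ v, l2Norm (v - u) ≤ ε → g v = g u), (ε : ℝ≥0∞)

end Polytopes

/-! ### The polyhedral complex of a network -/

namespace ReLUNet

/-- The inequalities, in the variable `x`, which say that the network, fed with `M x + c`, has the
activation code `R` and that `y` is a label of highest score. -/
def inequalities {K n : ℕ} (y : Fin K) : {m : ℕ} → (N : ReLUNet K m) → N.Code →
    Matrix (Fin m) (Fin n) ℝ → (Fin m → ℝ) → HPolytope (Fin n)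
  | _, output W b, _, M, c =>
      List.ofFn fun j => ⟨(W * M) j - (W * M) y, (W *ᵥ c + b) y - (W *ᵥ c + b) j⟩
  | _, hidden W b rest, R, M, c =>
      (List.ofFn fun i => if R.1 i then ⟨-(W * M) i, (W *ᵥ c + b) i⟩
        else ⟨(W * M) i, -(W *ᵥ c + b) i⟩) ++
      rest.inequalities y R.2 (Matrix.of fun i => if R.1 i then (W * M) i else 0)
        (fun i => if R.1 i then (W *ᵥ c + b) i else 0)

/-- The polyhedral complex of the network: the full-dimensional polytopes on which the activation
code is `R` and the label `y` has the highest score, for all `R` and `y`. On each of them the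
logits are affine, and the decision regions are unions of them. -/
def polytopes {K n : ℕ} (N : ReLUNet K n) : Set (HPolytope (Fin n)) :=
  {P | ∃ (R : N.Code) (y : Fin K), P = N.inequalities y R 1 0 ∧ P.FullDim}

end ReLUNet

/-! ### Sensitive features, individual fairness and FairProof -/

section Fairness

variable {n : ℕ} {S : Finset (Fin n)}

/-- The non-sensitive features of `x`. -/
def nonsensitive (S : Finset (Fin n)) (x : Fin n → ℝ) : {i // i ∉ S} → ℝ := fun i => x i

/-- The data point with non-sensitive features `u` and sensitive features `s`. -/
def combine (u : {i // i ∉ S} → ℝ) (s : {i // i ∈ S} → ℝ) : Fin n → ℝ :=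
  fun i => if h : i ∈ S then s ⟨i, h⟩ else u ⟨i, h⟩

/-- All combinations of values of the sensitive features. -/
def sensitiveDomain (dom : {i // i ∈ S} → Finset ℝ) : Finset ({i // i ∈ S} → ℝ) :=
  Fintype.piFinset dom

/-- `f` is `ε`-individually fair at `x`: all data points whose non-sensitive features are at `ℓ₂`
distance at most `ε` from those of `x` have the label of `x`. -/
def IndividuallyFair {Y : Type} (f : (Fin n → ℝ) → Y) (dom : {i // i ∈ S} → Finset ℝ)
    (x : Fin n → ℝ) (ε : ℝ) : Prop :=
  ∀ z : Fin n → ℝ, (∀ i : {i // i ∈ S}, z i ∈ dom i) →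
    l2Norm (nonsensitive S z - nonsensitive S x) ≤ ε → f z = f x

/-- The local individual fairness parameter of `f` at `x`. -/
def fairnessParameter {Y : Type} (f : (Fin n → ℝ) → Y) (dom : {i // i ∈ S} → Finset ℝ)
    (x : Fin n → ℝ) : ℝ≥0∞ :=
  ⨆ (ε : ℝ≥0) (_ : IndividuallyFair f dom x ε), (ε : ℝ≥0∞)

/-- Substituting the values `s` of the sensitive features into the inequalities of a polytope. -/
def HPolytope.reduce (P : HPolytope (Fin n)) (s : {i // i ∈ S} → ℝ) : HPolytope {i // i ∉ S} :=
  List.map (fun h : Halfspace (Fin n) =>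
    (⟨fun j => h.a j, h.b - ∑ j : {i // i ∈ S}, h.a j * s j⟩ : Halfspace {i // i ∉ S})) P

/-- Reduction of a complex to the polytopes of dimension `n - |S|` for the values `s` of the
sensitive features. -/
def reducePolyDim (PP : Set (HPolytope (Fin n))) (s : {i // i ∈ S} → ℝ) :
    Set (HPolytope {i // i ∉ S}) :=
  {P' | ∃ P ∈ PP, P' = HPolytope.reduce P s ∧ P'.FullDim}

/-- The classifier with the sensitive features fixed to `s`. -/
def sliceClassifier {K : ℕ} [NeZero K] (N : ReLUNet K n) (s : {i // i ∈ S} → ℝ)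
    (u : {i // i ∉ S} → ℝ) : Fin K :=
  N.predict (combine u s)

/-- FairProof can output the certificate `ε` for the data point `x`: for every combination `s` of
sensitive values the complex of the network is reduced and GeoCert is run on it, and `ε` is the
minimum of the values returned. -/
def FairProof {K : ℕ} [NeZero K] (N : ReLUNet K n) (dom : {i // i ∈ S} → Finset ℝ)
    (x : Fin n → ℝ) (ε : ℝ≥0∞) : Prop :=
  ∃ E : ({i // i ∈ S} → ℝ) → ℝ≥0∞,
    (∀ s ∈ sensitiveDomain dom,
      GeoCert (sliceClassifier N s) (reducePolyDim N.polytopes s) (nonsensitive S x) (E s)) ∧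
    ε = (sensitiveDomain dom).inf E

end Fairness

end

open Filter Topology

/-! Fix sensitive values `s`. The reduced polytopes are finitely many and full-dimensional, cover
the space, meet face to face, and carry one label on each interior. When GeoCert halts with value
`ε`, the seen polytopes all have the same label, and each of their facets either has projection
distance at least `ε` or has only seen neighbours (`GeoCertLoop.exists_seen`).

Let `V` be an open ball about the start point of radius below `ε`. The projection distance never
exceeds the distance to a point of the hyperplane, so facets whose hyperplane meets `V` have only
seen neighbours. A generic segment in `V` meets the hyperplanes one at a time and so passes between
polytopes only through facets; hence the seen polytopes cover `V`
(`FaceToFace.subset_iUnion_of_neighbors_subset`). Regularity of the decision regions extends the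
common label from interiors to all of `V` (`GeoCert.eq_of_lt`).

`FaceToFace` is phrased through tight inequalities: in this form it can be proved layer by layer
(`ReLUNet.inequalities_faceToFace`) and survives the substitution of `s`, even where the slice lies
in the boundary of a polytope. -/

/-- The nonzeros of a nonzero affine function are dense. -/
theorem AffineMap.dense_ne_zero {ι : Type} {f : (ι → ℝ) →ᵃ[ℝ] ℝ} (hf : f ≠ 0) : Dense {y | f y ≠ 0} := by
  obtain ⟨z, hz⟩ : ∃ z, f z ≠ 0 := by
    by_contra! h
    exact hf (AffineMap.ext h)
  intro y
  by_cases hy : f y = 0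
  -- Approach `y` along the line to `z`, where `f` equals `t * f z`.
  · have hlim : Tendsto (fun t : ℝ => AffineMap.lineMap y z t) (𝓝[≠] 0) (𝓝 y) := by
      have hc : Continuous fun t : ℝ => AffineMap.lineMap (k := ℝ) y z t :=
        AffineMap.lineMap_continuous
      simpa using (hc.tendsto 0).mono_left nhdsWithin_le_nhds
    refine mem_closure_of_tendsto hlim ?_
    filter_upwards [self_mem_nhdsWithin] with t ht
    have hval : f (AffineMap.lineMap y z t) = t * f z := by
      rw [AffineMap.apply_lineMap, hy, AffineMap.lineMap_apply_ring', sub_zero, add_zero]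
    change f (AffineMap.lineMap y z t) ≠ 0
    rw [hval]
    exact mul_ne_zero ht hz
  · exact subset_closure hy

/-! ### Polytopes: interiors, coverings and facets -/

section Polytopes

variable {ι : Type} [Fintype ι]

/-- The affine function `y ↦ a · y - b` that is nonpositive on the half-space `a · y ≤ b`. -/
noncomputable def Halfspace.excess (h : Halfspace ι) : (ι → ℝ) →ᵃ[ℝ] ℝ :=
  (dotProductBilin ℝ ℝ h.a : (ι → ℝ) →ₗ[ℝ] ℝ).toAffineMap - AffineMap.const ℝ _ h.b

theorem Halfspace.excess_apply (h : Halfspace ι) (y : ι → ℝ) :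
    h.excess y = h.a ⬝ᵥ y - h.b := by
  simp [Halfspace.excess]

theorem Halfspace.continuous_dotProduct (h : Halfspace ι) :
    Continuous fun y : ι → ℝ => h.a ⬝ᵥ y := by
  unfold dotProduct
  fun_prop

theorem Halfspace.excess_ne_zero {h : Halfspace ι} (ha : h.a ≠ 0) : h.excess ≠ 0 := by
  intro h0
  have key : ∀ y, h.a ⬝ᵥ y - h.b = 0 := fun y => by
    rw [← h.excess_apply, h0]; rfl
  have hb : h.b = 0 := by simpa using key 0
  have := key h.a
  rw [hb, sub_zero, dotProduct_self_eq_zero] at this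
  exact ha this

theorem HPolytope.isClosed_carrier (P : HPolytope ι) : IsClosed P.carrier := by
  have : P.carrier = ⋂ h ∈ P, {x : ι → ℝ | h.a ⬝ᵥ x ≤ h.b} := by
    ext x; simp [HPolytope.carrier]
  rw [this]
  exact isClosed_biInter fun h _ => isClosed_le h.continuous_dotProduct continuous_const

theorem HPolytope.convex_carrier (P : HPolytope ι) : Convex ℝ P.carrier := by
  intro x hx y hy s t hs ht hst h hh
  have h1 := mul_le_mul_of_nonneg_left (hx h hh) hs
  have h2 := mul_le_mul_of_nonneg_left (hy h hh) ht
  rw [dotProduct_add, dotProduct_smul, dotProduct_smul, smul_eq_mul, smul_eq_mul]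
  calc _ ≤ s * h.b + t * h.b := add_le_add h1 h2
    _ = h.b := by rw [← add_mul, hst, one_mul]

/-- Convexity lets every point of the polytope be approximated by interior points, where labels are
known. -/
theorem HPolytope.FullDim.carrier_subset {P : HPolytope ι} (hP : P.FullDim) :
    P.carrier ⊆ closure (interior P.carrier) := by
  rw [P.convex_carrier.closure_interior_eq_closure_of_nonempty_interior hP]
  exact subset_closure

/-- Near a point of a polytope, only the inequalities that are tight at this point matter. -/
theorem HPolytope.eventually_mem_carrier {P : HPolytope ι} {w : ι → ℝ} (hw : w ∈ P.carrier) :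
    ∀ᶠ y in 𝓝 w, (∀ h ∈ P, h.a ⬝ᵥ w = h.b → h.a ⬝ᵥ y ≤ h.b) → y ∈ P.carrier := by
  have : ∀ᶠ y in 𝓝 w, ∀ h ∈ {h | h ∈ P}, h.a ⬝ᵥ w ≠ h.b → h.a ⬝ᵥ y ≤ h.b := by
    rw [eventually_all_finite (List.finite_toSet P)]
    intro h hh
    by_cases hne : h.a ⬝ᵥ w = h.b
    · exact Eventually.of_forall fun y hy => absurd hne hy
    · have hlt : h.a ⬝ᵥ w < h.b := lt_of_le_of_ne (hw h hh) hne
      filter_upwards [h.continuous_dotProduct.continuousAt.eventually_lt_const hlt] with y hy _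
      exact hy.le
  filter_upwards [this] with y hy hy' h hh
  by_cases hne : h.a ⬝ᵥ w = h.b
  · exact hy' h hh hne
  · exact hy h hh hne

/-- A point of a polytope at which no proper inequality is tight is an interior point. -/
theorem HPolytope.mem_interior {P : HPolytope ι} {w : ι → ℝ} (hw : w ∈ P.carrier)
    (ht : ∀ h ∈ P, h.a ⬝ᵥ w = h.b → h.a = 0) : w ∈ interior P.carrier := by
  rw [mem_interior_iff_mem_nhds]
  filter_upwards [P.eventually_mem_carrier hw] with y hy
  refine hy fun h hh heq => ?_
  have h0 := ht h hh heq
  rw [h0, zero_dotProduct] at heq ⊢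
  exact heq.le

/-- At an interior point, no proper inequality is tight. -/
theorem HPolytope.eq_zero_of_mem_interior {P : HPolytope ι} {w : ι → ℝ}
    (hw : w ∈ interior P.carrier) {h : Halfspace ι} (hh : h ∈ P) (heq : h.a ⬝ᵥ w = h.b) :
    h.a = 0 := by
  -- A small step from `w` along the outward normal stays in `P`, which forces `t * (h.a ⬝ᵥ h.a) ≤
  -- 0`.
  have hlim : Tendsto (fun t : ℝ => w + t • h.a) (𝓝[>] 0) (𝓝 w) := by
    have hc : Continuous fun t : ℝ => w + t • h.a := by fun_prop
    simpa using (hc.tendsto 0).mono_left nhdsWithin_le_nhds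
  obtain ⟨t, ht, ht0⟩ := ((hlim.eventually (mem_interior_iff_mem_nhds.1 hw)).and
    self_mem_nhdsWithin).exists
  have h1 := ht h hh
  rw [dotProduct_add, heq, dotProduct_smul, smul_eq_mul] at h1
  have h2 : h.a ⬝ᵥ h.a ≤ 0 := by
    by_contra hpos
    have := mul_pos (Set.mem_Ioi.1 ht0) (not_le.1 hpos)
    linarith
  have h3 : 0 ≤ h.a ⬝ᵥ h.a := Finset.sum_nonneg fun i _ => mul_self_nonneg _
  exact dotProduct_self_eq_zero.1 (le_antisymm h2 h3)

/-- A nonempty open set has a point at which none of finitely many nonzero affine functions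
vanishes. -/
theorem exists_forall_affine_ne_zero {Φ : Set ((ι → ℝ) →ᵃ[ℝ] ℝ)} (hΦ : Φ.Finite)
    {O : Set (ι → ℝ)} (hO : IsOpen O) (hne : O.Nonempty) :
    ∃ y ∈ O, ∀ f ∈ Φ, f ≠ 0 → f y ≠ 0 := by
  have hd : Dense (⋂ f ∈ {f ∈ Φ | f ≠ 0}, {y | f y ≠ 0}) := by
    refine dense_biInter_of_isOpen (fun f _ => ?_) (hΦ.subset (Set.sep_subset _ _)).countable
      fun f hf => AffineMap.dense_ne_zero hf.2
    exact isOpen_ne_fun f.continuous_of_finiteDimensional continuous_const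
  obtain ⟨y, hyO, hy⟩ := hd.inter_open_nonempty O hO hne
  refine ⟨y, hyO, fun f hf h0 => ?_⟩
  simp only [Set.mem_iInter] at hy
  exact hy f ⟨hf, h0⟩

/-- If finitely many polytopes cover the space, then so do the full-dimensional ones. -/
theorem exists_fullDim_of_cover {PP : Set (HPolytope ι)} (hfin : PP.Finite)
    (hcov : ∀ u, ∃ P ∈ PP, u ∈ P.carrier) (u : ι → ℝ) :
    ∃ P ∈ PP, P.FullDim ∧ u ∈ P.carrier := by
  have hcl : IsClosed (⋃ P ∈ {P ∈ PP | P.FullDim}, P.carrier) :=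
    (hfin.subset (Set.sep_subset _ _)).isClosed_biUnion fun P _ => P.isClosed_carrier
  -- Closed sets with empty interior: finitely many of them cannot fill the open complement of the
  -- full-dimensional part.
  have hd : Dense (⋂ P ∈ {P ∈ PP | ¬ P.FullDim}, P.carrierᶜ) := by
    refine dense_biInter_of_isOpen (fun P _ => P.isClosed_carrier.isOpen_compl)
      (hfin.subset (Set.sep_subset _ _)).countable fun P hP => ?_
    exact interior_eq_empty_iff_dense_compl.1 (Set.not_nonempty_iff_eq_empty.1 hP.2)
  by_contra! hu
  obtain ⟨y, hy, hy'⟩ := hd.inter_open_nonempty _ hcl.isOpen_compl ⟨u, by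
    simpa using hu⟩
  obtain ⟨P, hP, hyP⟩ := hcov y
  simp only [Set.mem_iInter, Set.mem_compl_iff, Set.mem_iUnion] at hy hy'
  by_cases hf : P.FullDim
  · exact hy ⟨P, ⟨hP, hf⟩, hyP⟩
  · exact hy' P ⟨hP, hf⟩ hyP

/-- A nonempty face cut out by a proper inequality such that all inequalities that are tight at
some point of it are implied to be tight by this one is a facet. -/
theorem HPolytope.isCodimOne_face {P : HPolytope ι} {w : ι → ℝ} (hw : w ∈ P.carrier)
    {h : Halfspace ι} (ha : h.a ≠ 0) (hhw : h.a ⬝ᵥ w = h.b)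
    (ht : ∀ h' ∈ P, h'.a ⬝ᵥ w = h'.b → ∀ y, h.a ⬝ᵥ y = h.b → h'.a ⬝ᵥ y = h'.b) :
    IsCodimOne (P.face h) := by
  have hwF : w ∈ P.face h := ⟨hw, hhw⟩
  refine ⟨⟨w, hwF⟩, ?_⟩
  set φ : Module.Dual ℝ (ι → ℝ) := dotProductBilin ℝ ℝ h.a with hφ
  have hφa : ∀ v, φ v = h.a ⬝ᵥ v := fun v => rfl
  have hφ0 : φ ≠ 0 := by
    intro h0
    have := hφa h.a
    rw [h0] at this
    exact ha (dotProduct_self_eq_zero.1 this.symm)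
  have hspan : vectorSpan ℝ (P.face h) = LinearMap.ker φ := by
    apply le_antisymm
    · rw [vectorSpan_def, Submodule.span_le]
      rintro _ ⟨y, hy, z, hz, rfl⟩
      simp only [vsub_eq_sub, SetLike.mem_coe, LinearMap.mem_ker, hφa, dotProduct_sub]
      rw [hy.2, hz.2, sub_self]
    -- Moving from `w` along `v` keeps the tight inequalities tight and, for small `t`, the slack
    -- ones satisfied; so `t • v` is a difference of points of the face.
    · intro v hv
      rw [LinearMap.mem_ker, hφa] at hv
      have hlim : Tendsto (fun t : ℝ => w + t • v) (𝓝[≠] 0) (𝓝 w) := by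
        have hc : Continuous fun t : ℝ => w + t • v := by fun_prop
        simpa using (hc.tendsto 0).mono_left nhdsWithin_le_nhds
      obtain ⟨t, h1, h0⟩ := ((hlim.eventually (P.eventually_mem_carrier hw)).and
        self_mem_nhdsWithin).exists
      have hH : h.a ⬝ᵥ (w + t • v) = h.b := by
        rw [dotProduct_add, dotProduct_smul, hv, hhw, smul_zero, add_zero]
      have hmem : w + t • v ∈ P.face h :=
        ⟨h1 fun h' hh' heq => (ht h' hh' heq _ hH).le, hH⟩
      have := vsub_mem_vectorSpan ℝ hmem hwF
      rw [vsub_eq_sub, add_sub_cancel_left] at this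
      exact (Submodule.smul_mem_iff _ h0).1 this
  rw [hspan, Module.Dual.finrank_ker_add_one_of_ne_zero hφ0, Module.finrank_fintype_fun_eq_card]

/-! ### Face-to-face complexes and crossing of facets -/

/-- Any two polytopes meet in a common face. -/
def FaceToFace (PP : Set (HPolytope ι)) : Prop :=
  ∀ P ∈ PP, ∀ P' ∈ PP, ∀ w ∈ P.carrier, w ∈ P'.carrier → ∀ y ∈ P.carrier,
    (∀ h ∈ P, h.a ⬝ᵥ w = h.b → h.a ⬝ᵥ y = h.b) → y ∈ P'.carrier

/-- In a complex, two polytopes share a facet if they meet at a point that lies on only one of the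
hyperplanes and is not interior to the first polytope. -/
theorem FaceToFace.exists_common_facet {PP : Set (HPolytope ι)} (hface : FaceToFace PP)
    {P P' : HPolytope ι} (hP : P ∈ PP) (hP' : P' ∈ PP) {w : ι → ℝ} (hw : w ∈ P.carrier)
    (hw' : w ∈ P'.carrier) (hint : w ∉ interior P.carrier)
    (hone : ∀ h ∈ P ++ P', ∀ h' ∈ P ++ P', h.a ≠ 0 → h'.a ≠ 0 → h.a ⬝ᵥ w = h.b →
      h'.a ⬝ᵥ w = h'.b → ∀ y, h.a ⬝ᵥ y = h.b → h'.a ⬝ᵥ y = h'.b) :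
    ∃ h ∈ P, h.a ≠ 0 ∧ h.a ⬝ᵥ w = h.b ∧ IsCodimOne (P.face h) ∧ P.face h ∈ P'.facets := by
  obtain ⟨h, hh, hhw, ha⟩ : ∃ h ∈ P, h.a ⬝ᵥ w = h.b ∧ h.a ≠ 0 := by
    by_contra! hcon
    exact hint (P.mem_interior hw hcon)
  obtain ⟨h', hh', hhw', ha'⟩ : ∃ h ∈ P', h.a ⬝ᵥ w = h.b ∧ h.a ≠ 0 := by
    by_contra! hcon
    -- If only trivial inequalities of `P'` are tight at `w`, then `w` is interior to `P'`, and
    -- `FaceToFace` gives `P' ⊆ P`, so `w` would be interior to `P`.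
    refine hint (interior_mono (fun y hy => hface P' hP' P hP w hw' hw y hy ?_)
      (P'.mem_interior hw' hcon))
    intro h hh heq
    have h0 := hcon h hh heq
    rw [h0, zero_dotProduct] at heq ⊢
    exact heq
  have tight : ∀ g ∈ P ++ P', g.a ≠ 0 → g.a ⬝ᵥ w = g.b → ∀ k ∈ P ++ P', k.a ⬝ᵥ w = k.b →
      ∀ y, g.a ⬝ᵥ y = g.b → k.a ⬝ᵥ y = k.b := by
    intro g hg hga hgw k hk hkw y hy
    by_cases hk0 : k.a = 0
    · rw [hk0, zero_dotProduct] at hkw ⊢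
      exact hkw
    · exact hone g hg k hk hga hk0 hgw hkw y hy
  have mP : ∀ {g}, g ∈ P → g ∈ P ++ P' := fun hg => List.mem_append_left _ hg
  have mP' : ∀ {g}, g ∈ P' → g ∈ P ++ P' := fun hg => List.mem_append_right _ hg
  have hF : P.face h = P'.face h' := by
    ext y
    constructor
    · rintro ⟨hy, hyh⟩
      exact ⟨hface P hP P' hP' w hw hw' y hy fun k hk hkw =>
        tight h (mP hh) ha hhw k (mP hk) hkw y hyh,
        tight h (mP hh) ha hhw h' (mP' hh') hhw' y hyh⟩
    · rintro ⟨hy, hyh⟩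
      exact ⟨hface P' hP' P hP w hw' hw y hy fun k hk hkw =>
        tight h' (mP' hh') ha' hhw' k (mP' hk) hkw y hyh,
        tight h' (mP' hh') ha' hhw' h (mP hh) hhw y hyh⟩
  have hcod : IsCodimOne (P.face h) := P.isCodimOne_face hw ha hhw fun k hk hkw =>
    tight h (mP hh) ha hhw k (mP hk) hkw
  exact ⟨h, hh, ha, hhw, hcod, h', hh', hF, hcod⟩

/-- A set of polytopes of a complex that is closed under passing to neighbours through facets
whose hyperplanes meet the open convex set `V` covers `V`. -/
theorem FaceToFace.subset_iUnion_of_neighbors_subset {PP : Set (HPolytope ι)}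
    (hface : FaceToFace PP) (hfin : PP.Finite) (hcov : ∀ u, ∃ P ∈ PP, u ∈ P.carrier)
    {C : Set (HPolytope ι)} (hC : C ⊆ PP) {V : Set (ι → ℝ)} (hV : IsOpen V) (hVc : Convex ℝ V)
    {P₀ : HPolytope ι} (hP₀ : P₀ ∈ C) (hfull : P₀.FullDim) {x : ι → ℝ} (hx : x ∈ P₀.carrier)
    (hxV : x ∈ V)
    (hstep : ∀ P ∈ C, ∀ h ∈ P, IsCodimOne (P.face h) → (∃ w ∈ V, h.a ⬝ᵥ w = h.b) →
      neighbors PP (P.face h) ⊆ C) :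
    V ⊆ ⋃ P ∈ C, P.carrier := by
  set U : Set (ι → ℝ) := ⋃ P ∈ C, P.carrier with hU
  have hUcl : IsClosed U := (hfin.subset hC).isClosed_biUnion fun P _ => P.isClosed_carrier
  have hUcl' : IsClosed (⋃ P ∈ PP \ C, P.carrier) :=
    (hfin.subset Set.sdiff_subset).isClosed_biUnion fun P _ => P.isClosed_carrier
  set E : Set (Halfspace ι) := ⋃ P ∈ PP, {h | h ∈ P} with hE
  have hEfin : E.Finite := hfin.biUnion fun P _ => List.finite_toSet P
  have memE : ∀ {P h}, P ∈ PP → h ∈ P → h ∈ E := fun hP hh =>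
    Set.mem_biUnion hP hh
  by_contra hsub
  obtain ⟨v, hvV, hvU⟩ := Set.not_subset.1 hsub
  -- The start `p` of the segment avoids every hyperplane.
  obtain ⟨p, ⟨hpV, hpP⟩, hp⟩ := exists_forall_affine_ne_zero (hEfin.image Halfspace.excess)
    (hV.inter (isOpen_interior (s := P₀.carrier)))
    (mem_closure_iff.1 (hfull.carrier_subset hx) V hV hxV)
  -- Each combination vanishes at `p`. If it is not identically zero and `q` avoids its zeros, the
  -- segment cannot meet both hyperplanes at one point; if it is identically zero, the hyperplanes
  -- coincide.
  have hΦ : ((fun e : Halfspace ι × Halfspace ι =>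
      e.1.excess p • e.2.excess - e.2.excess p • e.1.excess) '' (E ×ˢ E)).Finite :=
    (hEfin.prod hEfin).image _
  obtain ⟨q, ⟨hqV, hqU⟩, hq⟩ := exists_forall_affine_ne_zero hΦ
    (hV.inter hUcl.isOpen_compl) ⟨v, hvV, hvU⟩
  set γ : ℝ → (ι → ℝ) := fun t => AffineMap.lineMap p q t with hγ
  have hγc : Continuous γ := AffineMap.lineMap_continuous
  -- The last time at which the segment is in the seen region.
  obtain ⟨t, ⟨⟨ht0, ht1⟩, htU⟩, htmax⟩ : ∃ t, IsGreatest (Set.Icc 0 1 ∩ γ ⁻¹' U) t := by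
    refine (isCompact_Icc.inter_right (hUcl.preimage hγc)).exists_isGreatest ⟨0, by simp, ?_⟩
    simp only [hγ, Set.mem_preimage, AffineMap.lineMap_apply_zero]
    exact Set.mem_biUnion hP₀ (interior_subset hpP)
  have htlt : t < 1 := by
    refine lt_of_le_of_ne ht1 fun h1 => hqU ?_
    rw [h1] at htU
    simpa [hγ] using htU
  have hafter : ∀ r ∈ Set.Ioc t 1, γ r ∉ U := fun r hr hrU =>
    not_lt.2 (htmax ⟨⟨ht0.trans hr.1.le, hr.2⟩, hrU⟩) hr.1
  obtain ⟨P, hPC, hwP⟩ : ∃ P ∈ C, γ t ∈ P.carrier := by simpa [hU] using htU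
  have hcl : t ∈ closure (Set.Ioc t 1) := by
    rw [closure_Ioc htlt.ne]
    exact ⟨le_rfl, ht1⟩
  -- Right after `t` only unseen polytopes cover the segment, and their union is closed.
  obtain ⟨P', hP', hwP'⟩ : ∃ P' ∈ PP \ C, γ t ∈ P'.carrier := by
    have : γ t ∈ ⋃ P ∈ PP \ C, P.carrier := by
      refine (hUcl'.preimage hγc).closure_subset_iff.2 ?_ hcl
      intro r hr
      obtain ⟨R, hR, hrR⟩ := hcov (γ r)
      exact Set.mem_biUnion ⟨hR, fun hRC => hafter r hr (Set.mem_biUnion hRC hrR)⟩ hrR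
    simpa using this
  have hint : γ t ∉ interior P.carrier := by
    intro hin
    obtain ⟨r, hr, hr'⟩ := mem_closure_iff.1 hcl _ (isOpen_interior.preimage hγc) hin
    exact hafter r hr' (Set.mem_biUnion hPC (interior_subset hr))
  have hone : ∀ h ∈ E, ∀ h' ∈ E, h.a ≠ 0 → h'.a ≠ 0 → h.a ⬝ᵥ γ t = h.b →
      h'.a ⬝ᵥ γ t = h'.b → ∀ y, h.a ⬝ᵥ y = h.b → h'.a ⬝ᵥ y = h'.b := by
    intro h hh h' hh' ha ha' e e' y hy
    have hp1 := hp _ ⟨h, hh, rfl⟩ (Halfspace.excess_ne_zero ha)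
    have line : ∀ k : Halfspace ι, k.a ⬝ᵥ γ t = k.b →
        (1 - t) * k.excess p + t * k.excess q = 0 := by
      intro k hk
      have : k.excess (γ t) = 0 := by rw [k.excess_apply, hk, sub_self]
      rw [hγ, AffineMap.apply_lineMap, AffineMap.lineMap_apply_ring'] at this
      linarith
    have l1 := line h e
    have l2 := line h' e'
    have htne : t ≠ 0 := by
      rintro rfl
      exact hp1 (by linarith)
    have hzero : h.excess p • h'.excess - h'.excess p • h.excess = 0 := by
      by_contra hne
      refine hq _ ⟨(h, h'), ⟨hh, hh'⟩, rfl⟩ hne ?_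
      have : t * (h.excess p * h'.excess q - h'.excess p * h.excess q) = 0 := by
        linear_combination h.excess p * l2 - h'.excess p * l1
      simpa using (mul_eq_zero.1 this).resolve_left htne
    have hy0 := congrArg (fun f : (ι → ℝ) →ᵃ[ℝ] ℝ => f y) hzero
    have hhy : h.excess y = 0 := by rw [h.excess_apply, hy, sub_self]
    simp only [AffineMap.coe_sub, AffineMap.coe_smul, Pi.sub_apply, Pi.smul_apply, smul_eq_mul,
      hhy, mul_zero, sub_zero, AffineMap.coe_zero, Pi.zero_apply] at hy0
    have := (mul_eq_zero.1 hy0).resolve_left hp1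
    rw [h'.excess_apply] at this
    linarith
  have memE' : ∀ h ∈ P ++ P', h ∈ E := by
    intro h hh
    rcases List.mem_append.1 hh with hh | hh
    exacts [memE (hC hPC) hh, memE hP'.1 hh]
  obtain ⟨h, hh, -, hhw, hcod, hfac⟩ := hface.exists_common_facet (hC hPC) hP'.1 hwP hwP' hint
    fun h hh h' hh' => hone h (memE' h hh) h' (memE' h' hh')
  refine hP'.2 (hstep P hPC h hh hcod ⟨γ t, ?_, hhw⟩ ⟨hP'.1, hfac⟩)
  exact hVc.lineMap_mem hpV hqV ⟨ht0, ht1⟩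

/-! ### GeoCert: soundness and termination -/

/-- The projection distance to a hyperplane is at most the distance to any of its points. -/
theorem projDist_le_l2Norm (x : ι → ℝ) {h : Halfspace ι} {w : ι → ℝ} (hw : h.a ⬝ᵥ w = h.b) :
    projDist x h ≤ l2Norm (w - x) := by
  have h1 : |h.b - h.a ⬝ᵥ x| ≤ l2Norm h.a * l2Norm (w - x) := by
    have := abs_real_inner_le_norm (WithLp.toLp 2 (w - x) : EuclideanSpace ℝ ι)
      (WithLp.toLp 2 h.a)
    rw [EuclideanSpace.inner_toLp_toLp, star_trivial, dotProduct_sub, hw, mul_comm] at this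
    exact this
  have h0 : 0 ≤ l2Norm h.a := norm_nonneg _
  rw [projDist, abs_div, abs_of_nonneg h0]
  -- This includes `h.a = 0`, where the quotient is `0`.
  exact div_le_of_le_mul₀ h0 (norm_nonneg _) (by rwa [mul_comm])

variable {Y : Type} {g : (ι → ℝ) → Y} {PP : Set (HPolytope ι)} {x : ι → ℝ}

/-- Polytopes that share a facet which is not a boundary facet carry the same label. -/
theorem eq_label_of_not_isBoundary {P P' : HPolytope ι} (hP : P.FullDim) (hP' : P'.FullDim)
    {F : Set (ι → ℝ)} (hF : F ⊆ P.carrier) (hF' : F ⊆ P'.carrier) (hb : ¬ IsBoundary g F)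
    {c c' : Y} (hc : ∀ u ∈ interior P.carrier, g u = c)
    (hc' : ∀ u ∈ interior P'.carrier, g u = c') : c' = c := by
  obtain ⟨w, hwF, hw⟩ := Set.not_subset.1 hb
  -- A point off the decision boundary is interior to its own region, and both polytopes have
  -- interior points arbitrarily close to it.
  have hwi : w ∈ interior {v | g v = g w} := by
    by_contra hni
    exact hw ⟨g w, subset_closure rfl, hni⟩
  obtain ⟨y, hy, hyP⟩ := mem_closure_iff.1 (hP.carrier_subset (hF hwF)) _ isOpen_interior hwi
  obtain ⟨z, hz, hzP⟩ := mem_closure_iff.1 (hP'.carrier_subset (hF' hwF)) _ isOpen_interior hwi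
  have h1 : g y = g w := by simpa using interior_subset hy
  have h2 : g z = g w := by simpa using interior_subset hz
  rw [← hc y hyP, ← hc' z hzP, h1, h2]

/-- When the loop of GeoCert halts, the seen polytopes carry the same label, and they are closed
under passing to neighbours through facets at a distance less than the returned value. -/
theorem GeoCertLoop.exists_seen (hfull : ∀ P ∈ PP, P.FullDim)
    (hlab : ∀ P ∈ PP, ∃ c, ∀ u ∈ interior P.carrier, g u = c)
    {Q : Set (ℝ × Set (ι → ℝ))} {C : Set (HPolytope ι)} {ε : ℝ≥0∞}
    (hloop : GeoCertLoop g PP x Q C ε) {c : Y} (hC : C ⊆ PP)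
    (hlabC : ∀ P ∈ C, ∀ u ∈ interior P.carrier, g u = c)
    (hQ : ∀ e ∈ Q, ∃ P ∈ C, e ∈ P.entries x)
    (hCQ : ∀ P ∈ C, ∀ e ∈ P.entries x, e ∈ Q ∨ neighbors PP e.2 ⊆ C) :
    ∃ C', C ⊆ C' ∧ C' ⊆ PP ∧ (∀ P ∈ C', ∀ u ∈ interior P.carrier, g u = c) ∧
      ∀ P ∈ C', ∀ e ∈ P.entries x, ε ≤ ENNReal.ofReal e.1 ∨ neighbors PP e.2 ⊆ C' := by
  induction hloop with
  | exhausted C =>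
    exact ⟨C, subset_rfl, hC, hlabC, fun P hP e he => (hCQ P hP e he).imp_left fun h => h.elim⟩
  | found Q C d F hmem hmin hF =>
    exact ⟨C, subset_rfl, hC, hlabC, fun P hP e he => (hCQ P hP e he).imp_left fun h =>
      ENNReal.ofReal_le_ofReal (hmin e h)⟩
  | expand Q C d F ε hmem hmin hF hrest ih =>
    obtain ⟨P, hPC, h, hh, hcod, heq⟩ := hQ _ hmem
    have hFP : F = P.face h := (Prod.ext_iff.1 heq).2
    refine (ih (Set.union_subset hC fun R hR => hR.1) ?_ ?_ ?_).imp fun C' hC' =>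
      ⟨Set.subset_union_left.trans hC'.1, hC'.2⟩
    · rintro R (hR | hR)
      · exact hlabC R hR
      · obtain ⟨hRP, k, hk, hFk, -⟩ := hR
        obtain ⟨c', hc'⟩ := hlab R hRP
        have : c' = c := eq_label_of_not_isBoundary (hfull P (hC hPC)) (hfull R hRP)
          (hFP ▸ fun y hy => hy.1) (hFk ▸ fun y hy => hy.1) hF (hlabC P hPC) hc'
        exact this ▸ hc'
    · rintro e (he | he)
      · obtain ⟨R, hR, heR⟩ := hQ e he.1
        exact ⟨R, Or.inl hR, heR⟩
      · simp only [Set.mem_iUnion] at he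
        obtain ⟨R, hR, heR⟩ := he
        exact ⟨R, Or.inr hR.1, heR⟩
    · intro R hR e he
      by_cases hRC : R ∈ C
      · rcases hCQ R hRC e he with h3 | h3
        -- The popped entry leaves the queue, but all its neighbours have just become seen.
        · by_cases hed : e = (d, F)
          · right
            rw [hed]
            exact Set.subset_union_right
          · exact Or.inl (Or.inl ⟨h3, hed⟩)
        · exact Or.inr (h3.trans Set.subset_union_left)
      · left; right
        exact Set.mem_biUnion ⟨hR.resolve_left hRC, hRC⟩ he

/-- All points at a distance less than the value returned by GeoCert have the label of `x`. -/
theorem GeoCert.eq_of_lt (hface : FaceToFace PP) (hfin : PP.Finite)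
    (hcov : ∀ u, ∃ P ∈ PP, u ∈ P.carrier) (hfull : ∀ P ∈ PP, P.FullDim)
    (hlab : ∀ P ∈ PP, ∃ c, ∀ u ∈ interior P.carrier, g u = c)
    (hreg : ∀ c, {u | g u = c} ⊆ closure (interior {u | g u = c})) {ε : ℝ≥0∞}
    (hg : GeoCert g PP x ε) {v : ι → ℝ} (hv : ENNReal.ofReal (l2Norm (v - x)) < ε) :
    g v = g x := by
  obtain ⟨P₀, hP₀, hx, hloop⟩ := hg
  obtain ⟨c, hc⟩ := hlab P₀ hP₀
  obtain ⟨C, h0, hC, hlabC, hnb⟩ := hloop.exists_seen hfull hlab (c := c)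
    (by simpa using hP₀) (by simpa using hc) (fun e he => ⟨P₀, rfl, he⟩)
    (by rintro P rfl e he; exact Or.inl he)
  obtain ⟨r, hr1, hr2⟩ : ∃ r : ℝ, l2Norm (v - x) < r ∧ ENNReal.ofReal r < ε := by
    obtain ⟨r, h1, h2⟩ := ENNReal.lt_iff_exists_nnreal_btwn.1 hv
    refine ⟨r, ?_, by simpa using h2⟩
    have := (ENNReal.ofReal_lt_ofReal_iff_of_nonneg (norm_nonneg _)).1
      (show ENNReal.ofReal (l2Norm (v - x)) < ENNReal.ofReal (r : ℝ) by simpa using h1)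
    exact this
  set V : Set (ι → ℝ) := {y | l2Norm (y - x) < r} with hVdef
  -- `ι → ℝ` carries the sup norm, so openness and convexity are pulled back from Euclidean space.
  have hVpre : V = (WithLp.linearEquiv 2 ℝ (ι → ℝ)).symm ⁻¹'
      Metric.ball (WithLp.toLp 2 x : EuclideanSpace ℝ ι) r := by
    ext y
    simp only [hVdef, l2Norm, Set.mem_ofPred_eq, Set.mem_preimage, mem_ball_iff_norm]
    rfl
  have hVo : IsOpen V := by
    rw [hVpre]
    exact Metric.isOpen_ball.preimage (PiLp.continuous_toLp 2 fun _ : ι => ℝ)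
  have hVc : Convex ℝ V := by
    rw [hVpre]
    exact (convex_ball _ _).linear_preimage
      ((WithLp.linearEquiv 2 ℝ (ι → ℝ)).symm : (ι → ℝ) →ₗ[ℝ] EuclideanSpace ℝ ι)
  have hvV : v ∈ V := hr1
  have hxV : x ∈ V := by
    have : l2Norm (x - x) = 0 := by simp [l2Norm]
    simp only [hVdef, Set.mem_ofPred_eq, this]
    exact (norm_nonneg _).trans_lt hr1
  have hcover := hface.subset_iUnion_of_neighbors_subset hfin hcov hC hVo hVc (h0 rfl)
    (hfull P₀ hP₀) hx hxV (by
      rintro P hP h hh hcod ⟨w, hwV, hw⟩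
      refine (hnb P hP (projDist x h, P.face h) ⟨h, hh, hcod, rfl⟩).resolve_left ?_
      refine not_le.2 (lt_of_le_of_lt (ENNReal.ofReal_le_ofReal ?_) hr2)
      exact (projDist_le_l2Norm x hw).trans (le_of_lt hwV))
  have hconst : ∀ y ∈ V, g y = c := by
    intro y hy
    -- Near `y` there is an open set of points with the label of `y`; it meets the interior of a
    -- seen polytope.
    obtain ⟨z, hz, hzV⟩ := mem_closure_iff.1 (hreg (g y) rfl) V hVo hy
    obtain ⟨P, hP, hzP⟩ : ∃ P ∈ C, z ∈ P.carrier := by simpa using hcover hz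
    obtain ⟨z', hz', hzP'⟩ := mem_closure_iff.1 ((hfull P (hC hP)).carrier_subset hzP) _
      isOpen_interior hzV
    have h1 : g z' = g y := by simpa using interior_subset hz'
    rw [← h1, hlabC P hP z' hzP']
  rw [hconst v hvV, hconst x hxV]

theorem HPolytope.finite_entries (P : HPolytope ι) (x : ι → ℝ) : (P.entries x).Finite := by
  refine ((List.finite_toSet P).image fun h => (projDist x h, P.face h)).subset ?_
  rintro e ⟨h, hh, -, rfl⟩
  exact ⟨h, hh, rfl⟩

/-- The loop of GeoCert can halt. -/
theorem GeoCertLoop.exists_value (hfin : PP.Finite) (g : (ι → ℝ) → Y) (x : ι → ℝ) (m : ℕ) :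
    ∀ (C : Set (HPolytope ι)), (PP \ C).ncard = m → ∀ (k : ℕ) (Q : Set (ℝ × Set (ι → ℝ))),
      Q.Finite → Q.ncard = k → ∃ ε, GeoCertLoop g PP x Q C ε := by
  -- Lexicographic induction: unseen polytopes first, then queue size. An expansion either shrinks
  -- the queue or reveals a new polytope.
  induction m using Nat.strong_induction_on with
  | _ m ihm =>
  intro C hC k
  induction k using Nat.strong_induction_on with
  | _ k ihk =>
  intro Q hQ hk
  rcases Q.eq_empty_or_nonempty with rfl | hne
  · exact ⟨_, .exhausted C⟩
  obtain ⟨⟨d, F⟩, hmem, hmin⟩ := hQ.exists_minimalFor (fun e => e.1) Q hne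
  replace hmin : ∀ e ∈ Q, d ≤ e.1 := fun e he => (le_total d e.1).elim id fun h => hmin he h
  by_cases hF : IsBoundary g F
  · exact ⟨_, .found Q C d F hmem hmin hF⟩
  suffices ∃ ε, GeoCertLoop g PP x ((Q \ {(d, F)}) ∪ ⋃ P ∈ neighbors PP F \ C, P.entries x)
      (C ∪ neighbors PP F) ε by
    obtain ⟨ε, hε⟩ := this
    exact ⟨ε, .expand Q C d F ε hmem hmin hF hε⟩
  by_cases hN : neighbors PP F ⊆ C
  · rw [Set.union_eq_self_of_subset_right hN, Set.sdiff_eq_empty.2 hN, Set.biUnion_empty,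
      Set.union_empty]
    exact ihk _ (hk ▸ Set.ncard_sdiff_singleton_lt_of_mem hmem hQ) _ hQ.sdiff rfl
  · obtain ⟨P, hP, hPC⟩ := Set.not_subset.1 hN
    have hlt : (PP \ (C ∪ neighbors PP F)).ncard < m :=
      hC ▸ Set.ncard_lt_ncard ⟨Set.sdiff_subset_sdiff_right Set.subset_union_left, fun h =>
        (h ⟨hP.1, hPC⟩).2 (Or.inr hP)⟩ hfin.sdiff
    have hNfin : (neighbors PP F \ C).Finite := hfin.subset fun P hP => hP.1.1
    exact ihm _ hlt _ rfl _ _ (hQ.sdiff.union (hNfin.biUnion fun P _ => P.finite_entries x)) rfl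

theorem GeoCert.exists_value (hfin : PP.Finite) (hcov : ∀ u, ∃ P ∈ PP, u ∈ P.carrier)
    (g : (ι → ℝ) → Y) (x : ι → ℝ) : ∃ ε, GeoCert g PP x ε := by
  obtain ⟨P, hP, hx⟩ := hcov x
  obtain ⟨ε, hε⟩ := GeoCertLoop.exists_value hfin g x _ {P} rfl _ _ (P.finite_entries x) rfl
  exact ⟨ε, P, hP, hx, hε⟩

end Polytopes

/-! ### The polyhedral complex of a network -/

namespace ReLUNet

variable {K n : ℕ}

instance finite_code : {m : ℕ} → (N : ReLUNet K m) → Finite N.Code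
  | _, output _ _ => inferInstanceAs (Finite Unit)
  | _, hidden (m := m) _ _ rest =>
    have := finite_code rest
    inferInstanceAs (Finite ((Fin m → Bool) × rest.Code))

/-- Translates the rows stored by `inequalities` into preactivations of the layer at `M *ᵥ x + c`.
-/
theorem mulVec_affine {l m : ℕ} (W : Matrix (Fin l) (Fin m) ℝ) (b : Fin l → ℝ)
    (M : Matrix (Fin m) (Fin n) ℝ) (c : Fin m → ℝ) (x : Fin n → ℝ) (i : Fin l) :
    (W * M) i ⬝ᵥ x + (W *ᵥ c + b) i = (W *ᵥ (M *ᵥ x + c) + b) i := by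
  rw [Matrix.mulVec_add, Matrix.mulVec_mulVec]
  simp only [Pi.add_apply]
  rw [← add_assoc]
  rfl

/-- The inequality of a hidden neuron `i` in an activation code, for the affine preactivation
`x ↦ A x + d`. -/
def neuronHalfspace {l : ℕ} (A : Matrix (Fin l) (Fin n) ℝ) (d : Fin l → ℝ) (r : Fin l → Bool)
    (i : Fin l) : Halfspace (Fin n) :=
  if r i then ⟨-A i, d i⟩ else ⟨A i, -d i⟩

theorem neuronHalfspace_le_iff {l : ℕ} (A : Matrix (Fin l) (Fin n) ℝ) (d : Fin l → ℝ)
    (r : Fin l → Bool) (i : Fin l) (x : Fin n → ℝ) :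
    (neuronHalfspace A d r i).a ⬝ᵥ x ≤ (neuronHalfspace A d r i).b ↔
      if r i then 0 ≤ A i ⬝ᵥ x + d i else A i ⬝ᵥ x + d i ≤ 0 := by
  unfold neuronHalfspace
  split_ifs
  · rw [neg_dotProduct]
    constructor <;> intro h <;> linarith
  · dsimp only
    constructor <;> intro h <;> linarith

theorem neuronHalfspace_eq_iff {l : ℕ} (A : Matrix (Fin l) (Fin n) ℝ) (d : Fin l → ℝ)
    (r : Fin l → Bool) (i : Fin l) (x : Fin n → ℝ) :
    (neuronHalfspace A d r i).a ⬝ᵥ x = (neuronHalfspace A d r i).b ↔ A i ⬝ᵥ x + d i = 0 := by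
  unfold neuronHalfspace
  split_ifs
  · rw [neg_dotProduct]
    constructor <;> intro h <;> linarith
  · dsimp only
    constructor <;> intro h <;> linarith

/-- On the points that satisfy the inequalities of an activation code, masking agrees with
ReLU. -/
theorem masked_eq_relu {l : ℕ} (A : Matrix (Fin l) (Fin n) ℝ) (d : Fin l → ℝ)
    (r : Fin l → Bool) (x : Fin n → ℝ)
    (hx : ∀ i, (neuronHalfspace A d r i).a ⬝ᵥ x ≤ (neuronHalfspace A d r i).b) :
    (Matrix.of fun i => if r i then A i else 0) *ᵥ x + (fun i => if r i then d i else 0) =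
      fun i => max (A i ⬝ᵥ x + d i) 0 := by
  funext i
  have h := (neuronHalfspace_le_iff A d r i x).1 (hx i)
  simp only [Pi.add_apply, Matrix.mulVec, Matrix.of_apply]
  split_ifs at h ⊢ with hr
  · rw [max_eq_left h]
  · rw [max_eq_right h, zero_dotProduct, add_zero]

theorem mem_inequalities_output {m : ℕ} (y : Fin K) (W : Matrix (Fin K) (Fin m) ℝ)
    (b : Fin K → ℝ) (R : (output W b).Code) (M : Matrix (Fin m) (Fin n) ℝ) (c : Fin m → ℝ)
    (h : Halfspace (Fin n)) :
    h ∈ (output W b).inequalities y R M c ↔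
      ∃ j, h = ⟨(W * M) j - (W * M) y, (W *ᵥ c + b) y - (W *ᵥ c + b) j⟩ := by
  simp only [inequalities, List.mem_ofFn, eq_comm]

theorem mem_inequalities_hidden {m l : ℕ} (y : Fin K) (W : Matrix (Fin l) (Fin m) ℝ)
    (b : Fin l → ℝ) (rest : ReLUNet K l) (R : (hidden W b rest).Code)
    (M : Matrix (Fin m) (Fin n) ℝ) (c : Fin m → ℝ) (h : Halfspace (Fin n)) :
    h ∈ (hidden W b rest).inequalities y R M c ↔
      (∃ i, h = neuronHalfspace (W * M) (W *ᵥ c + b) R.1 i) ∨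
      h ∈ rest.inequalities y R.2 (Matrix.of fun i => if R.1 i then (W * M) i else 0)
        (fun i => if R.1 i then (W *ᵥ c + b) i else 0) := by
  simp only [inequalities, List.mem_append, List.mem_ofFn, eq_comm, neuronHalfspace]

/-- The relation between two polytopes of a network (with possibly different parametrizations of
the input, which agree at the points considered) that makes them meet face to face. -/
theorem inequalities_faceToFace : ∀ {m : ℕ} (N : ReLUNet K m) (y y' : Fin K) (R R' : N.Code)
    (M M' : Matrix (Fin m) (Fin n) ℝ) (c c' : Fin m → ℝ) (w x : Fin n → ℝ),
    M *ᵥ w + c = M' *ᵥ w + c' → M *ᵥ x + c = M' *ᵥ x + c' →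
    w ∈ (N.inequalities y R M c).carrier → w ∈ (N.inequalities y' R' M' c').carrier →
    x ∈ (N.inequalities y R M c).carrier →
    (∀ h ∈ N.inequalities y R M c, h.a ⬝ᵥ w = h.b → h.a ⬝ᵥ x = h.b) →
    x ∈ (N.inequalities y' R' M' c').carrier
  | _, output W b, y, y', R, R', M, M', c, c', w, x, hw, hx, hwP, hwP', hxP, ht => by
    intro h hh
    obtain ⟨j, rfl⟩ := (mem_inequalities_output ..).1 hh
    have mem := fun i => (mem_inequalities_output y W b R M c _).2 ⟨i, rfl⟩
    have e1 := fun i => mulVec_affine W b M c w i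
    have e2 := fun i => mulVec_affine W b M' c' w i
    have e3 := fun i => mulVec_affine W b M c x i
    have e4 := fun i => mulVec_affine W b M' c' x i
    simp only [hw] at e1
    simp only [hx] at e3
    have w1 := hwP _ (mem y')
    have w2 := hwP' _ ((mem_inequalities_output ..).2 ⟨y, rfl⟩)
    have t1 := ht _ (mem y')
    have x1 := hxP _ (mem j)
    simp only [sub_dotProduct] at w1 w2 t1 x1 ⊢
    -- `w1` and `w2` make `y` and `y'` tie at `w`; tightness carries the tie to `x`, where `y` is a
    -- top label.
    have t2 := t1 (by linarith [e1 y, e1 y', e2 y, e2 y'])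
    linarith [e3 y, e3 y', e3 j, e4 y, e4 y', e4 j]
  | _, hidden W b rest, y, y', R, R', M, M', c, c', w, x, hw, hx, hwP, hwP', hxP, ht => by
    have mem := fun i =>
      (mem_inequalities_hidden y W b rest R M c _).2 (Or.inl ⟨i, rfl⟩)
    have mem' := fun i =>
      (mem_inequalities_hidden y' W b rest R' M' c' _).2 (Or.inl ⟨i, rfl⟩)
    have ew : ∀ i, (W * M) i ⬝ᵥ w + (W *ᵥ c + b) i = (W * M') i ⬝ᵥ w + (W *ᵥ c' + b) i :=
      fun i => by rw [mulVec_affine, mulVec_affine, hw]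
    have ex : ∀ i, (W * M) i ⬝ᵥ x + (W *ᵥ c + b) i = (W * M') i ⬝ᵥ x + (W *ᵥ c' + b) i :=
      fun i => by rw [mulVec_affine, mulVec_affine, hx]
    have hfirst : ∀ i, (neuronHalfspace (W * M') (W *ᵥ c' + b) R'.1 i).a ⬝ᵥ x ≤
        (neuronHalfspace (W * M') (W *ᵥ c' + b) R'.1 i).b := by
      intro i
      have w1 := (neuronHalfspace_le_iff ..).1 (hwP _ (mem i))
      have w2 := (neuronHalfspace_le_iff ..).1 (hwP' _ (mem' i))
      have x1 := (neuronHalfspace_le_iff ..).1 (hxP _ (mem i))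
      have t1 := ht _ (mem i)
      rw [neuronHalfspace_eq_iff, neuronHalfspace_eq_iff, ew, ex] at t1
      rw [neuronHalfspace_le_iff]
      rw [ew] at w1
      rw [ex] at x1
      -- Where the two bits differ, the preactivation is zero at `w`, hence at `x`, so either bit
      -- fits.
      split_ifs at w1 w2 x1 ⊢
      · exact x1
      · exact (t1 (le_antisymm w1 w2)).ge
      · exact (t1 (le_antisymm w2 w1)).le
      · exact x1
    -- The two masked parametrizations may differ as matrices, but at `w` and `x` both compute the
    -- ReLU output.
    have hrest := inequalities_faceToFace rest y y' R.2 R'.2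
      (Matrix.of fun i => if R.1 i then (W * M) i else 0)
      (Matrix.of fun i => if R'.1 i then (W * M') i else 0)
      (fun i => if R.1 i then (W *ᵥ c + b) i else 0)
      (fun i => if R'.1 i then (W *ᵥ c' + b) i else 0) w x
      (by
        rw [masked_eq_relu _ _ _ _ fun i => hwP _ (mem i),
          masked_eq_relu _ _ _ _ fun i => hwP' _ (mem' i)]
        simp only [ew])
      (by
        rw [masked_eq_relu _ _ _ _ fun i => hxP _ (mem i), masked_eq_relu _ _ _ _ hfirst]
        simp only [ex])
      (fun h hh => hwP h ((mem_inequalities_hidden ..).2 (Or.inr hh)))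
      (fun h hh => hwP' h ((mem_inequalities_hidden ..).2 (Or.inr hh)))
      (fun h hh => hxP h ((mem_inequalities_hidden ..).2 (Or.inr hh)))
      (fun h hh => ht h ((mem_inequalities_hidden ..).2 (Or.inr hh)))
    intro h hh
    rcases (mem_inequalities_hidden ..).1 hh with ⟨i, rfl⟩ | hh
    · exact hfirst i
    · exact hrest h hh

theorem mem_carrier_output_iff {m : ℕ} (y : Fin K) (W : Matrix (Fin K) (Fin m) ℝ)
    (b : Fin K → ℝ) (R : (output W b).Code) (M : Matrix (Fin m) (Fin n) ℝ) (c : Fin m → ℝ)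
    (x : Fin n → ℝ) :
    x ∈ ((output W b).inequalities y R M c).carrier ↔
      y ∈ (output W b).topLabels (M *ᵥ x + c) := by
  have e := fun i => mulVec_affine W b M c x i
  simp only [topLabels, Finset.mem_filter, Finset.mem_univ, true_and, logits, ← e]
  constructor
  · intro h j
    have := h _ ((mem_inequalities_output ..).2 ⟨j, rfl⟩)
    simp only [sub_dotProduct] at this
    linarith
  · intro h k hk
    obtain ⟨j, rfl⟩ := (mem_inequalities_output ..).1 hk
    have := h j
    simp only [sub_dotProduct]
    linarith

theorem mem_carrier_hidden_iff {m l : ℕ} (y : Fin K) (W : Matrix (Fin l) (Fin m) ℝ)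
    (b : Fin l → ℝ) (rest : ReLUNet K l) (R : (hidden W b rest).Code)
    (M : Matrix (Fin m) (Fin n) ℝ) (c : Fin m → ℝ) (x : Fin n → ℝ) :
    x ∈ ((hidden W b rest).inequalities y R M c).carrier ↔
      (∀ i, (neuronHalfspace (W * M) (W *ᵥ c + b) R.1 i).a ⬝ᵥ x ≤
        (neuronHalfspace (W * M) (W *ᵥ c + b) R.1 i).b) ∧
      x ∈ (rest.inequalities y R.2 (Matrix.of fun i => if R.1 i then (W * M) i else 0)
        (fun i => if R.1 i then (W *ᵥ c + b) i else 0)).carrier := by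
  constructor
  · exact fun h => ⟨fun i => h _ ((mem_inequalities_hidden ..).2 (Or.inl ⟨i, rfl⟩)),
      fun k hk => h k ((mem_inequalities_hidden ..).2 (Or.inr hk))⟩
  · rintro ⟨h1, h2⟩ k hk
    rcases (mem_inequalities_hidden ..).1 hk with ⟨i, rfl⟩ | hk
    · exact h1 i
    · exact h2 k hk

theorem topLabels_hidden {m l : ℕ} (W : Matrix (Fin l) (Fin m) ℝ) (b : Fin l → ℝ)
    (rest : ReLUNet K l) (x : Fin m → ℝ) :
    (hidden W b rest).topLabels x = rest.topLabels fun i => max ((W *ᵥ x + b) i) 0 := rfl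

/-- Once the activation code fits, the inequalities say that the label has the highest score. -/
theorem mem_carrier_iff_mem_topLabels : ∀ {m : ℕ} (N : ReLUNet K m) (y y' : Fin K) (R : N.Code)
    (M : Matrix (Fin m) (Fin n) ℝ) (c : Fin m → ℝ) (x : Fin n → ℝ),
    x ∈ (N.inequalities y R M c).carrier →
    (x ∈ (N.inequalities y' R M c).carrier ↔ y' ∈ N.topLabels (M *ᵥ x + c))
  | _, output W b, y, y', R, M, c, x, hx => mem_carrier_output_iff ..
  | _, hidden W b rest, y, y', R, M, c, x, hx => by
    rw [mem_carrier_hidden_iff] at hx ⊢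
    rw [mem_carrier_iff_mem_topLabels rest y y' _ _ _ _ hx.2, masked_eq_relu _ _ _ _ hx.1]
    simp only [hx.1, implies_true, true_and, topLabels_hidden, mulVec_affine]

/-- Every point belongs to the polytope of some activation code, for each label of highest
score. -/
theorem exists_code_mem_carrier : ∀ {m : ℕ} (N : ReLUNet K m) (y : Fin K)
    (M : Matrix (Fin m) (Fin n) ℝ) (c : Fin m → ℝ) (x : Fin n → ℝ),
    y ∈ N.topLabels (M *ᵥ x + c) → ∃ R : N.Code, x ∈ (N.inequalities y R M c).carrier
  | _, output W b, y, M, c, x, hy => ⟨(), (mem_carrier_output_iff ..).2 hy⟩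
  | _, hidden (m := l) W b rest, y, M, c, x, hy => by
    set r : Fin l → Bool := fun i => decide (0 ≤ (W * M) i ⬝ᵥ x + (W *ᵥ c + b) i) with hr
    have h1 : ∀ i, (neuronHalfspace (W * M) (W *ᵥ c + b) r i).a ⬝ᵥ x ≤
        (neuronHalfspace (W * M) (W *ᵥ c + b) r i).b := by
      intro i
      rw [neuronHalfspace_le_iff]
      simp only [hr, decide_eq_true_eq]
      split_ifs with h
      · exact h
      · exact (not_le.1 h).le
    obtain ⟨R, hR⟩ := exists_code_mem_carrier rest y
      (Matrix.of fun i => if r i then (W * M) i else 0)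
      (fun i => if r i then (W *ᵥ c + b) i else 0) x (by
        rw [masked_eq_relu _ _ _ _ h1]
        simpa only [topLabels_hidden, mulVec_affine] using hy)
    exact ⟨(r, R), (mem_carrier_hidden_iff ..).2 ⟨h1, hR⟩⟩

theorem finite_setOf_inequalities (N : ReLUNet K n) :
    {P | ∃ (R : N.Code) (y : Fin K), P = N.inequalities (n := n) y R 1 0}.Finite := by
  refine (Set.finite_range fun e : N.Code × Fin K => N.inequalities (n := n) e.2 e.1 1 0).subset ?_
  rintro P ⟨R, y, rfl⟩
  exact ⟨(R, y), rfl⟩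

theorem finite_polytopes (N : ReLUNet K n) : N.polytopes.Finite :=
  N.finite_setOf_inequalities.subset fun _ ⟨R, y, h, _⟩ => ⟨R, y, h⟩

theorem exists_mem_polytopes [NeZero K] (N : ReLUNet K n) (x : Fin n → ℝ) :
    ∃ P ∈ N.polytopes, x ∈ P.carrier := by
  obtain ⟨P, ⟨R, y, hP⟩, hf, hx⟩ := exists_fullDim_of_cover N.finite_setOf_inequalities
    (fun u => by
      obtain ⟨y, hy⟩ := N.topLabels_nonempty u
      obtain ⟨R, hR⟩ := N.exists_code_mem_carrier y 1 0 u (by simpa using hy)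
      exact ⟨_, ⟨R, y, rfl⟩, hR⟩) x
  exact ⟨P, ⟨R, y, hP, hf⟩, hx⟩

theorem polytopes_faceToFace (N : ReLUNet K n) : FaceToFace N.polytopes := by
  rintro _ ⟨R, y, rfl, -⟩ _ ⟨R', y', rfl, -⟩ w hw hw' x hx ht
  exact N.inequalities_faceToFace y y' R R' 1 1 0 0 w x rfl rfl hw hw' hx ht

/-- The prediction at a point of a polytope is determined by the inequalities that are tight. -/
theorem predict_eq_of_tight_iff [NeZero K] (N : ReLUNet K n) {P : HPolytope (Fin n)}
    (hP : P ∈ N.polytopes) {w x : Fin n → ℝ} (hw : w ∈ P.carrier) (hx : x ∈ P.carrier)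
    (ht : ∀ h ∈ P, h.a ⬝ᵥ w = h.b ↔ h.a ⬝ᵥ x = h.b) : N.predict w = N.predict x := by
  obtain ⟨R, y, rfl, -⟩ := hP
  have h1 : N.topLabels w = N.topLabels x := by
    ext y'
    have ew := N.mem_carrier_iff_mem_topLabels y y' R 1 0 w hw
    have ex := N.mem_carrier_iff_mem_topLabels y y' R 1 0 x hx
    rw [Matrix.one_mulVec, add_zero] at ew ex
    rw [← ew, ← ex]
    -- The polytope of `(R, y')` need not be full-dimensional, so `polytopes_faceToFace` would not
    -- suffice.
    exact ⟨fun h => N.inequalities_faceToFace y y' R R 1 1 0 0 w x rfl rfl hw h hx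
        fun k hk => (ht k hk).1,
      fun h => N.inequalities_faceToFace y y' R R 1 1 0 0 x w rfl rfl hx h hw
        fun k hk => (ht k hk).2⟩
  simp only [predict, h1]

end ReLUNet

/-! ### Fixing the sensitive features -/

section Fairness

variable {n : ℕ} {S : Finset (Fin n)}

theorem dotProduct_combine (a : Fin n → ℝ) (u : {i // i ∉ S} → ℝ) (s : {i // i ∈ S} → ℝ) :
    a ⬝ᵥ combine u s =
      (fun j : {i // i ∉ S} => a j) ⬝ᵥ u + ∑ j : {i // i ∈ S}, a j * s j := by
  have h1 : ∀ j : {i // i ∉ S}, combine u s j = u j := fun j => by rw [combine, dif_neg j.2]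
  have h2 : ∀ j : {i // i ∈ S}, combine u s j = s j := fun j => by rw [combine, dif_pos j.2]
  rw [dotProduct, ← Fintype.sum_subtype_add_sum_subtype (fun i => i ∈ S), add_comm, dotProduct]
  simp only [h1, h2]
  congr!

theorem HPolytope.mem_carrier_reduce {P : HPolytope (Fin n)} {s : {i // i ∈ S} → ℝ}
    {u : {i // i ∉ S} → ℝ} : u ∈ (P.reduce s).carrier ↔ combine u s ∈ P.carrier := by
  simp only [HPolytope.carrier, HPolytope.reduce, Set.mem_ofPred_eq, List.forall_mem_map,
    dotProduct_combine, le_sub_iff_add_le]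

/-- The inequalities of a reduced polytope are tight where those of the polytope are. -/
theorem HPolytope.forall_mem_reduce {P : HPolytope (Fin n)} {s : {i // i ∈ S} → ℝ}
    {p : (({i // i ∉ S} → ℝ) → Prop) → Prop} :
    (∀ h ∈ P.reduce s, p fun u => h.a ⬝ᵥ u = h.b) ↔
      ∀ h ∈ P, p fun u => h.a ⬝ᵥ combine u s = h.b := by
  simp only [HPolytope.reduce, List.forall_mem_map, dotProduct_combine, eq_sub_iff_add_eq]

theorem finite_reducePolyDim {PP : Set (HPolytope (Fin n))} (hPP : PP.Finite)
    (s : {i // i ∈ S} → ℝ) : (reducePolyDim PP s).Finite := by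
  refine (hPP.image fun P => P.reduce s).subset ?_
  rintro _ ⟨P, hP, rfl, -⟩
  exact ⟨P, hP, rfl⟩

/-- Slices of a cover form a cover, and `exists_fullDim_of_cover` allows the lower-dimensional
slices to be discarded. -/
theorem exists_mem_reducePolyDim {PP : Set (HPolytope (Fin n))} (hPP : PP.Finite)
    (hcov : ∀ x, ∃ P ∈ PP, x ∈ P.carrier) (s : {i // i ∈ S} → ℝ) (u : {i // i ∉ S} → ℝ) :
    ∃ P ∈ reducePolyDim PP s, u ∈ P.carrier := by
  obtain ⟨_, ⟨P, hP, rfl⟩, hf, hu⟩ := exists_fullDim_of_cover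
    (hPP.image fun P => P.reduce s) (fun v => by
      obtain ⟨P, hP, hv⟩ := hcov (combine v s)
      exact ⟨_, ⟨P, hP, rfl⟩, HPolytope.mem_carrier_reduce.2 hv⟩) u
  exact ⟨_, ⟨P, hP, rfl, hf⟩, hu⟩

/-- Substitution acts on each inequality separately and preserves tightness, so the condition
transfers directly. -/
theorem FaceToFace.reducePolyDim {PP : Set (HPolytope (Fin n))} (hPP : FaceToFace PP)
    (s : {i // i ∈ S} → ℝ) : FaceToFace (reducePolyDim PP s) := by
  rintro _ ⟨P, hP, rfl, -⟩ _ ⟨P', hP', rfl, -⟩ w hw hw' y hy ht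
  rw [HPolytope.mem_carrier_reduce] at hw hw' hy ⊢
  exact hPP P hP P' hP' _ hw hw' _ hy
    (HPolytope.forall_mem_reduce (p := fun q => q w → q y).1 ht)

/-- The classifier with fixed sensitive features is constant on the interior of a reduced
polytope. -/
theorem exists_label_of_mem_reducePolyDim {K : ℕ} [NeZero K] (N : ReLUNet K n)
    (s : {i // i ∈ S} → ℝ) {P : HPolytope {i // i ∉ S}} (hP : P ∈ reducePolyDim N.polytopes s) :
    ∃ c, ∀ u ∈ interior P.carrier, sliceClassifier N s u = c := by
  obtain ⟨P, hP, rfl, v, hv⟩ := hP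
  refine ⟨_, fun u hu => N.predict_eq_of_tight_iff hP
    (HPolytope.mem_carrier_reduce.1 (interior_subset hu))
    (HPolytope.mem_carrier_reduce.1 (interior_subset hv))
    (HPolytope.forall_mem_reduce (p := fun q => q u ↔ q v).1 fun h hh => ?_)⟩
  -- Only inequalities with zero normal are tight at interior points of the slice, and these are
  -- tight everywhere; so `u` and `v` have the same tight inequalities.
  constructor <;> intro heq
  · have h0 := HPolytope.eq_zero_of_mem_interior hu hh heq
    change h.a ⬝ᵥ v = h.b
    rwa [h0, zero_dotProduct] at heq ⊢
  · have h0 := HPolytope.eq_zero_of_mem_interior hv hh heq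
    change h.a ⬝ᵥ u = h.b
    rwa [h0, zero_dotProduct] at heq ⊢

theorem combine_nonsensitive (z : Fin n → ℝ) :
    combine (nonsensitive S z) (fun i : {i // i ∈ S} => z i) = z := by
  funext i
  by_cases hi : i ∈ S <;> simp [combine, nonsensitive, hi]

end Fairness

/-! ### Correctness of FairProof -/

theorem mainTheorem2 {n K : ℕ} [NeZero K] (N : ReLUNet K n) (S : Finset (Fin n))
    (dom : {i // i ∈ S} → Finset ℝ) (x : Fin n → ℝ)
    (hreg : ∀ s ∈ sensitiveDomain dom, ∀ c : Fin K,
      {u | sliceClassifier N s u = c} ⊆ closure (interior {u | sliceClassifier N s u = c})) :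
    (∃ ε, FairProof N dom x ε) ∧
    ∀ ε, FairProof N dom x ε →
      (∀ s ∈ sensitiveDomain dom,
        ε ≤ robustnessRadius (sliceClassifier N s) (nonsensitive S x)) ∧
      (IndividuallyFair N.predict dom x 0 → ε ≤ fairnessParameter N.predict dom x) := by
  have hcov := fun s : {i // i ∈ S} → ℝ =>
    exists_mem_reducePolyDim N.finite_polytopes N.exists_mem_polytopes s
  constructor
  · choose E hE using fun s : {i // i ∈ S} → ℝ =>
      GeoCert.exists_value (finite_reducePolyDim N.finite_polytopes s) (hcov s)
        (sliceClassifier N s) (nonsensitive S x)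
    exact ⟨_, E, fun s _ => hE s, rfl⟩
  · rintro _ ⟨E, hE, rfl⟩
    -- Radii strictly below the output suffice, since both targets are suprema.
    have key : ∀ s ∈ sensitiveDomain dom, ∀ r : ℝ≥0, (r : ℝ≥0∞) < (sensitiveDomain dom).inf E →
        ∀ v, l2Norm (v - nonsensitive S x) ≤ r →
          sliceClassifier N s v = sliceClassifier N s (nonsensitive S x) := by
      intro s hs r hr v hv
      refine GeoCert.eq_of_lt (N.polytopes_faceToFace.reducePolyDim s)
        (finite_reducePolyDim N.finite_polytopes s) (hcov s) (fun P ⟨_, _, _, h⟩ => h)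
        (fun P hP => exists_label_of_mem_reducePolyDim N s hP) (hreg s hs) (hE s hs) ?_
      calc ENNReal.ofReal (l2Norm (v - nonsensitive S x)) ≤ ENNReal.ofReal r :=
            ENNReal.ofReal_le_ofReal hv
        _ = r := ENNReal.ofReal_coe_nnreal
        _ < _ := hr.trans_le (Finset.inf_le hs)
    refine ⟨fun s hs => ENNReal.le_of_forall_nnreal_lt fun r hr => ?_,
      fun hfair => ENNReal.le_of_forall_nnreal_lt fun r hr => ?_⟩
    · exact le_iSup₂_of_le r (key s hs r hr) le_rfl
    · refine le_iSup₂_of_le r (fun z hz hzr => ?_) le_rfl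
      set s : {i // i ∈ S} → ℝ := fun i => z i with hs
      have hsd : s ∈ sensitiveDomain dom := Fintype.mem_piFinset.2 hz
      have h1 := key s hsd r hr (nonsensitive S z) hzr
      have hns : nonsensitive S (combine (nonsensitive S x) s) = nonsensitive S x := by
        funext i
        simp [nonsensitive, combine, i.2]
      -- The sensitive values of `x` need not lie in the domain; fairness at radius `0` links the
      -- centre of the slice to `x`.
      have h2 := hfair (combine (nonsensitive S x) s)
        (fun i => by simpa [combine, i.2] using hz i) (by simp [hns, l2Norm])
      rw [sliceClassifier, combine_nonsensitive] at h1
      exact h1.trans h2
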